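/- Let $K/F$ be a cyclic Galois field extension of degree $n$ with $\mathrm{Gal}(K/F)=\langle\sigma\rangle$, and let $R=K[t;\sigma]$ be the skew polynomial ring with $ta=\sigma(a)t$ for $a\in K$, so that the center of $R$ is $F[t^n]$. Let $f=\sum_{i=0}^m a_it^i\in R$ be a monic irreducible polynomial of degree $m$ such that the greatest common right divisor of $f$ and $t$ is $1$, and suppose that $f$ is not right-invariant, i.e. $fR\not\subseteq Rf$. Let $h(t)=\hat h(t^n)$, with $\hat h\in F[x]$ monic, be the minimal central left multiple of $f$, that is, the polynomial of least degree in the center of $R$ that is of this form and satisfies $h\in Rf$. Suppose that $\deg(h)=mn$. If $g$ is a monic (left or right) divisor of $h$ in $R$ of degree $ml$ with constant term $g_0$, then $$N_{K/F}(g_0)=N_{K/F}(a_0)^l.$$ -/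

import Mathlib

namespace SkewPoly

section

variable {A : Type*} [Semiring A]

/-- The degree of a skew polynomial: `⊥` for the zero polynomial, and otherwise the largest `i`
such that the coefficient of `t ^ i` is nonzero. -/
def degree (p : SkewPolynomial A) : WithBot ℕ := p.support.max

/-- A skew polynomial is monic if it is nonzero of some degree `d` and the coefficient of `t ^ d`
is one. -/
def IsMonic (p : SkewPolynomial A) : Prop :=
  ∃ d : ℕ, degree p = (d : WithBot ℕ) ∧ p.coeff d = 1

end

section

variable {R : Type*} [Semiring R]

/-- `g` is a right divisor of `h`: `h = q g` for some `q`. -/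
def IsRightDivisor (g h : R) : Prop := ∃ q : R, h = q * g

/-- `g` is a left divisor of `h`: `h = g q` for some `q`. -/
def IsLeftDivisor (g h : R) : Prop := ∃ q : R, h = g * q

/-- The greatest common right divisor of `f` and `g` is one: every common right divisor is a
unit. -/
def IsRightCoprime (f g : R) : Prop :=
  ∀ d : R, IsRightDivisor d f → IsRightDivisor d g → IsUnit d

/-- `f` is right-invariant: `f R ⊆ R f`, that is, the left ideal `R f` is two-sided. -/
def IsRightInvariant (f : R) : Prop := ∀ p : R, IsRightDivisor f (f * p)

end

section

variable {F K : Type*} [Field F] [Field K] [Algebra F K] [MulSemiringAction (Multiplicative ℕ) K]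

/-- The skew polynomial `hhat(t ^ n)` over `K`, for a commutative polynomial `hhat` in `F[x]`. -/
noncomputable def evalXPow (n : ℕ) (hhat : Polynomial F) : SkewPolynomial K :=
  hhat.eval₂ (SkewPolynomial.CRingHom.comp (algebraMap F K)) (SkewPolynomial.X ^ n)

variable (F) in
/-- `h` is a central left multiple of `f` of the form `h = hhat(t ^ n)` with `hhat` a monic
polynomial in `F[x]`. -/
def IsMonicCentralLeftMultiple (n : ℕ) (f h : SkewPolynomial K) : Prop :=
  h ∈ Subring.center (SkewPolynomial K) ∧ IsRightDivisor f h ∧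
    ∃ hhat : Polynomial F, hhat.Monic ∧ h = evalXPow n hhat

variable (F) in
/-- `h` is the minimal central left multiple of `f`: the one of least degree among the central
left multiples `hhat(t ^ n)` of `f` with `hhat` monic in `F[x]`. -/
def IsMinimalCentralLeftMultiple (n : ℕ) (f h : SkewPolynomial K) : Prop :=
  IsMonicCentralLeftMultiple F n f h ∧
    ∀ h' : SkewPolynomial K, IsMonicCentralLeftMultiple F n f h' → degree h ≤ degree h'

end

end SkewPoly

/-! The reduced norm `N = redNorm`, the determinant of a representation of `K[t;σ]` by matrices over
`K[X]`, is multiplicative into a commutative ring. Its values lie in `F[X ^ n]`, and `N(h) = ĥ(X ^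
n) ^ n` because `h` acts as a scalar matrix (`regularRep_evalXPow`). For `p` of degree `d`, the
constant term of `N(p)` is the field norm of `p.coeff 0`, and for monic `p` the coefficient of `X ^
(n * d)` is a sign to the power `d`.

Minimality of `h` and irreducibility of `f` make `ĥ` irreducible, and `deg h = mn` gives `deg ĥ =
m`. So a divisor `g` of degree `ml` has `N(g) = c ĥ(X ^ n) ^ l`, with `c` read off the top
coefficient. Constant terms give the norm of `g_0` as `c ĥ(0) ^ l`; the case `g = f`, `l = 1`
eliminates `ĥ(0)`, and the signs cancel. -/

namespace SkewPoly

open Polynomial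

/-! ### Matrix representation and reduced norm -/

section RegularRepresentation

open scoped Classical in
/-- The matrix of right multiplication by `t` on `K[t;σ]`, rows indexed by the Galois group and
graded by the central variable. -/
noncomputable def shiftMatrix {F K : Type*} [Field F] [Field K] [Algebra F K] (σ : K ≃ₐ[F] K) :
    Matrix (K ≃ₐ[F] K) (K ≃ₐ[F] K) K[X] :=
  Matrix.of fun τ ρ => if τ * σ = ρ then X else 0

variable {F K : Type*} [Field F] [Field K] [Algebra F K] [FiniteDimensional F K]
  {σ : K ≃ₐ[F] K}

open scoped Classical in
theorem shiftMatrix_pow_apply (k : ℕ) (τ ρ : K ≃ₐ[F] K) :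
    (shiftMatrix σ ^ k) τ ρ = if τ * σ ^ k = ρ then X ^ k else 0 := by
  induction k generalizing ρ with
  | zero => simp [Matrix.one_apply]
  | succ k ih =>
    rw [pow_succ, Matrix.mul_apply, Finset.sum_eq_single (τ * σ ^ k)]
    · rw [ih, if_pos rfl, shiftMatrix, Matrix.of_apply, mul_assoc, ← pow_succ, mul_ite, mul_zero,
        ← pow_succ]
    · intro b _ hb
      rw [ih, if_neg hb.symm, zero_mul]
    · simp

variable [MulSemiringAction (Multiplicative ℕ) K]

omit [FiniteDimensional F K] in
theorem iterate_phi (hφ : ∀ a : K, (SkewPolynomial.φ : K →+* K) a = σ a) (k : ℕ) (a : K) :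
    (SkewPolynomial.φ : K →+* K)^[k] a = (σ ^ k) a := by
  induction k with
  | zero => simp
  | succ k ih => rw [Function.iterate_succ_apply', ih, hφ, pow_succ', AlgEquiv.mul_apply]

open scoped Classical in
/-- The representation of `K[t;σ]` by matrices over `K[X]` sending `a t ^ k` to the matrix whose
entry at `(τ, τ σ ^ k)` is `τ a X ^ k`. -/
noncomputable def regularRep (hφ : ∀ a : K, (SkewPolynomial.φ : K →+* K) a = σ a) :
    SkewPolynomial K →+* Matrix (K ≃ₐ[F] K) (K ≃ₐ[F] K) K[X] :=
  SkewMonoidAlgebra.liftNCRingHom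
    ((Matrix.diagonalRingHom (K ≃ₐ[F] K) K[X]).comp
      (RingHom.pi fun τ : K ≃ₐ[F] K => C.comp (τ : K →+* K)))
    (powersHom _ (shiftMatrix σ)) (by
      intro x y
      have hy : y • x = (σ ^ y.toAdd) x := by
        rw [← iterate_phi hφ, SkewPolynomial.φ_iterate_apply]; rfl
      change Matrix.diagonal (fun τ : K ≃ₐ[F] K => C (τ (y • x))) * shiftMatrix σ ^ y.toAdd =
        shiftMatrix σ ^ y.toAdd * Matrix.diagonal (fun τ : K ≃ₐ[F] K => C (τ x))
      ext1 τ ρ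
      rw [Matrix.diagonal_mul, Matrix.mul_diagonal, shiftMatrix_pow_apply, hy]
      split_ifs with h
      · rw [← h, mul_comm, AlgEquiv.mul_apply]
      · rw [mul_zero, zero_mul])

variable (hφ : ∀ a : K, (SkewPolynomial.φ : K →+* K) a = σ a)

open scoped Classical in
theorem regularRep_monomial (k : ℕ) (a : K) (τ ρ : K ≃ₐ[F] K) :
    regularRep hφ (SkewPolynomial.monomial k a) τ ρ =
      if τ * σ ^ k = ρ then monomial k (τ a) else 0 := by
  have : regularRep hφ (SkewPolynomial.monomial k a) =
      Matrix.diagonal (fun τ : K ≃ₐ[F] K => C (τ a)) * shiftMatrix σ ^ k :=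
    SkewMonoidAlgebra.liftNC_single _ _ _ _
  rw [this, Matrix.diagonal_mul, shiftMatrix_pow_apply, mul_ite, mul_zero, C_mul_X_pow_eq_monomial]

open scoped Classical in
theorem coeff_regularRep (p : SkewPolynomial K) (k : ℕ) (τ ρ : K ≃ₐ[F] K) :
    (regularRep hφ p τ ρ).coeff k = if τ * σ ^ k = ρ then τ (p.coeff k) else 0 := by
  induction p using SkewPolynomial.induction with
  | h0 => simp
  | ha j a q _ _ ih =>
    have hc : (SkewPolynomial.monomial j a + q).coeff k =
        (SkewPolynomial.monomial j a).coeff k + q.coeff k := by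
      simp [SkewPolynomial.coeff]
    rw [map_add, Matrix.add_apply, coeff_add, ih, regularRep_monomial, hc,
      SkewPolynomial.coeff_monomial]
    by_cases hjk : j = k
    · subst hjk
      rw [if_pos (rfl : j = j)]
      split_ifs <;> simp
    · have : ((if τ * σ ^ j = ρ then monomial j (τ a) else 0 : K[X])).coeff k = 0 := by
        split_ifs <;> simp [coeff_monomial, hjk]
      rw [this, if_neg hjk, zero_add, zero_add]

open scoped Classical in
/-- The reduced norm of `K[t;σ]`, written in the variable `X` with `X ^ n` playing the role of the
central variable. -/
noncomputable def redNorm : SkewPolynomial K →* K[X] :=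
  Matrix.detMonoidHom.comp (regularRep hφ).toMonoidHom

open scoped Classical in
theorem redNorm_apply (p : SkewPolynomial K) : redNorm hφ p = (regularRep hφ p).det := rfl

theorem natDegree_regularRep_le {p : SkewPolynomial K} {d : ℕ} (hp : ∀ k, d < k → p.coeff k = 0)
    (τ ρ : K ≃ₐ[F] K) : (regularRep hφ p τ ρ).natDegree ≤ d := by
  classical
  rw [natDegree_le_iff_coeff_eq_zero]
  intro k hk
  simp [coeff_regularRep, hp k hk]

theorem natDegree_redNorm_le {p : SkewPolynomial K} {d : ℕ} (hp : ∀ k, d < k → p.coeff k = 0) :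
    (redNorm hφ p).natDegree ≤ Fintype.card (K ≃ₐ[F] K) * d := by
  classical
  rw [redNorm_apply, Matrix.det_apply]
  refine natDegree_sum_le_of_forall_le _ _ fun π _ => ?_
  refine (natDegree_smul_le _ _).trans ((natDegree_prod_le _ _).trans ?_)
  exact (Finset.sum_le_card_nsmul _ _ d fun τ _ => natDegree_regularRep_le hφ hp _ _).trans
    (by simp)

-- Entries have degree at most `d`, so the top coefficient of the determinant is the determinant of
-- the matrix of `X ^ d` coefficients: a diagonal of conjugates times the permutation matrix of
-- right translation by `σ ^ d`.
open scoped Classical in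
theorem coeff_redNorm_top [IsGalois F K] {p : SkewPolynomial K} {d : ℕ}
    (hp : ∀ k, d < k → p.coeff k = 0) :
    (redNorm hφ p).coeff (Fintype.card (K ≃ₐ[F] K) * d) =
      algebraMap F K (Algebra.norm F (p.coeff d)) *
        ((Equiv.Perm.sign (Equiv.mulRight σ) : ℤ) : K) ^ d := by
  have hA : (redNorm hφ p).coeff (Fintype.card (K ≃ₐ[F] K) * d) =
      (Matrix.of fun τ ρ => (regularRep hφ p τ ρ).coeff d).det := by
    rw [redNorm_apply, Matrix.det_apply, Matrix.det_apply, finsetSum_coeff]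
    refine Finset.sum_congr rfl fun π _ => ?_
    rw [Units.smul_def, Units.smul_def, coeff_smul]
    congr 1
    exact coeff_prod_of_natDegree_le _ _ _ fun τ _ => natDegree_regularRep_le hφ hp _ _
  have hB : (Matrix.of fun τ ρ => (regularRep hφ p τ ρ).coeff d) =
      Matrix.diagonal (fun τ : K ≃ₐ[F] K => τ (p.coeff d)) *
        (Equiv.mulRight σ ^ d : Equiv.Perm (K ≃ₐ[F] K)).permMatrix K := by
    ext τ ρ
    rw [Matrix.of_apply, coeff_regularRep, Matrix.diagonal_mul, Equiv.pow_mulRight]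
    simp [PEquiv.toMatrix_apply]
  rw [hA, hB, Matrix.det_mul, Matrix.det_diagonal, Matrix.det_permutation,
    Algebra.norm_eq_prod_automorphisms, map_pow]
  push_cast
  rfl

theorem coeff_zero_redNorm [IsGalois F K] (p : SkewPolynomial K) :
    (redNorm hφ p).coeff 0 = algebraMap F K (Algebra.norm F (p.coeff 0)) := by
  classical
  rw [coeff_zero_eq_eval_zero, redNorm_apply, ← coe_evalRingHom, RingHom.map_det,
    Algebra.norm_eq_prod_automorphisms, ← Matrix.det_diagonal]
  congr 1
  ext τ ρ
  simp [← coeff_zero_eq_eval_zero, coeff_regularRep, Matrix.diagonal_apply]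

/-- Applying `α` to the entry at `(τ, ρ)` gives the entry at `(α τ, α ρ)`. Rows and columns are thus
permuted alike, which preserves the determinant. -/
theorem redNorm_map (α : K ≃ₐ[F] K) (p : SkewPolynomial K) :
    (redNorm hφ p).map (α : K →+* K) = redNorm hφ p := by
  classical
  rw [redNorm_apply, ← coe_mapRingHom, RingHom.map_det,
    ← Matrix.det_submatrix_equiv_self (Equiv.mulLeft α) (regularRep hφ p)]
  congr 1
  ext τ ρ k
  by_cases h : τ * σ ^ k = ρ <;> simp [coeff_regularRep, mul_assoc, h]

end RegularRepresentation

/-! ### Polynomials homogeneous for a grading by a commutative group -/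

section Graded

theorem pow_eq_mul_of_coeff_mul_ne_zero {A G : Type*} [CommSemiring A] [CommGroup G] {s c d : G}
    {p q : A[X]} (hp : ∀ k, p.coeff k ≠ 0 → s ^ k = c) (hq : ∀ k, q.coeff k ≠ 0 → s ^ k = d)
    (k : ℕ) (hk : (p * q).coeff k ≠ 0) : s ^ k = c * d := by
  rw [coeff_mul] at hk
  obtain ⟨⟨i, j⟩, hij, hne⟩ := Finset.exists_ne_zero_of_sum_ne_zero hk
  rw [Finset.HasAntidiagonal.mem_antidiagonal] at hij
  simp only at hij hne
  rw [← hij, pow_add, hp i (left_ne_zero_of_mul hne), hq j (right_ne_zero_of_mul hne)]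

theorem pow_eq_prod_of_coeff_prod_ne_zero {A G ι : Type*} [CommSemiring A] [CommGroup G] {s : G}
    (t : Finset ι) (c : ι → G) (p : ι → A[X]) (hp : ∀ i k, (p i).coeff k ≠ 0 → s ^ k = c i)
    (k : ℕ) (hk : (∏ i ∈ t, p i).coeff k ≠ 0) : s ^ k = ∏ i ∈ t, c i := by
  classical
  induction t using Finset.induction_on generalizing k with
  | empty =>
    rw [Finset.prod_empty, coeff_one] at hk
    have : k = 0 := by by_contra h; simp [h] at hk
    simp [this]
  | insert i t hi ih =>
    rw [Finset.prod_insert hi] at hk ⊢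
    exact pow_eq_mul_of_coeff_mul_ne_zero (hp i) ih k hk

end Graded

/-! ### Values of the reduced norm in `F[X ^ n]`; central elements -/

section CyclicGalois

variable {F K : Type*} [Field F] [Field K] [Algebra F K] [FiniteDimensional F K]
  {σ : K ≃ₐ[F] K} [MulSemiringAction (Multiplicative ℕ) K]
  (hφ : ∀ a : K, (SkewPolynomial.φ : K →+* K) a = σ a)

/-- The entry at `(τ, ρ)` only has exponents `k` with `σ ^ k = τ⁻¹ ρ`. The Galois group being
commutative, these quotients multiply to `1` along any permutation in the Leibniz formula. -/
theorem pow_eq_one_of_coeff_redNorm_ne_zero (hσ : ∀ τ : K ≃ₐ[F] K, τ ∈ Subgroup.zpowers σ)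
    (p : SkewPolynomial K) (k : ℕ) (hk : (redNorm hφ p).coeff k ≠ 0) : σ ^ k = 1 := by
  classical
  have : IsCyclic (K ≃ₐ[F] K) := ⟨σ, hσ⟩
  let _ : CommGroup (K ≃ₐ[F] K) := IsCyclic.commGroup
  rw [redNorm_apply, Matrix.det_apply, finsetSum_coeff] at hk
  obtain ⟨π, _, hne⟩ := Finset.exists_ne_zero_of_sum_ne_zero hk
  rw [Units.smul_def, coeff_smul] at hne
  have h := pow_eq_prod_of_coeff_prod_ne_zero (s := σ) Finset.univ
    (fun τ : K ≃ₐ[F] K => (π τ)⁻¹ * τ) (fun τ => regularRep hφ p (π τ) τ) (by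
      intro τ j hj
      rw [coeff_regularRep] at hj
      have := (ite_ne_right_iff.mp hj).1
      exact eq_inv_mul_of_mul_eq this) k (right_ne_zero_of_smul hne)
  rw [h, Finset.prod_mul_distrib, Finset.prod_inv_distrib, Equiv.prod_comp π (fun τ => τ),
    inv_mul_cancel]

variable [IsGalois F K] {n : ℕ}

omit [MulSemiringAction (Multiplicative ℕ) K] in
theorem orderOf_eq_finrank (hσ : ∀ τ : K ≃ₐ[F] K, τ ∈ Subgroup.zpowers σ)
    (hn : Module.finrank F K = n) : orderOf σ = n := by
  rw [orderOf_eq_card_of_forall_mem_zpowers hσ, IsGalois.card_aut_eq_finrank, hn]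

/-- Galois descent puts the coefficients in `F`; the grading restricts the exponents to multiples of
the order `n` of `σ`. -/
theorem exists_redNorm_eq_map_expand (hσ : ∀ τ : K ≃ₐ[F] K, τ ∈ Subgroup.zpowers σ)
    (hn : Module.finrank F K = n) (p : SkewPolynomial K) :
    ∃ Q : F[X], redNorm hφ p = (expand F n Q).map (algebraMap F K) := by
  have hn0 : 0 < n := hn ▸ Module.finrank_pos
  have hl : redNorm hφ p ∈ lifts (algebraMap F K) := by
    rw [lifts_iff_coeff_lifts]
    intro k
    rw [IsGalois.mem_range_algebraMap_iff_fixed]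
    intro α
    conv_rhs => rw [← redNorm_map hφ α p]
    rw [coeff_map]
    rfl
  obtain ⟨Q, hQ⟩ := (mem_lifts _).mp hl
  refine ⟨contract n Q, ?_⟩
  rw [← hQ]
  congr 1
  ext k
  rw [coeff_expand hn0, coeff_contract hn0.ne']
  split_ifs with h
  · rw [Nat.div_mul_cancel h]
  · by_contra hk
    refine h ?_
    rw [← orderOf_eq_finrank hσ hn]
    refine orderOf_dvd_of_pow_eq_one (pow_eq_one_of_coeff_redNorm_ne_zero hφ hσ p k ?_)
    rwa [← hQ, coeff_map, _root_.map_ne_zero]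

omit [FiniteDimensional F K] [IsGalois F K] in
theorem evalXPow_monomial (i : ℕ) (c : F) :
    (evalXPow n (monomial i c) : SkewPolynomial K) =
      SkewPolynomial.monomial (n * i) (algebraMap F K c) := by
  rw [evalXPow, eval₂_monomial, RingHom.comp_apply, SkewPolynomial.CRingHom_eq_C, ← pow_mul,
    SkewPolynomial.C_mul_X_pow_eq_monomial]

open scoped Classical in
theorem regularRep_evalXPow (hσ : ∀ τ : K ≃ₐ[F] K, τ ∈ Subgroup.zpowers σ)
    (hn : Module.finrank F K = n) (a : F[X]) :
    regularRep hφ (evalXPow n a) =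
      Matrix.scalar (K ≃ₐ[F] K) ((expand F n a).map (algebraMap F K)) := by
  induction a using Polynomial.induction_on' with
  | add p q hp hq =>
    rw [evalXPow, eval₂_add, map_add, ← evalXPow, ← evalXPow, hp, hq, map_add, Polynomial.map_add,
      map_add]
  | monomial i c =>
    have h1 : σ ^ (n * i) = 1 := by
      rw [pow_mul, ← orderOf_eq_finrank hσ hn, pow_orderOf_eq_one, one_pow]
    ext1 τ ρ
    rw [evalXPow_monomial, regularRep_monomial, h1, mul_one, Matrix.scalar_apply,
      Matrix.diagonal_apply, expand_monomial, map_monomial, AlgEquiv.commutes, mul_comm n]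

theorem redNorm_evalXPow (hσ : ∀ τ : K ≃ₐ[F] K, τ ∈ Subgroup.zpowers σ)
    (hn : Module.finrank F K = n) (a : F[X]) :
    redNorm hφ (evalXPow n a) = (expand F n (a ^ n)).map (algebraMap F K) := by
  classical
  rw [redNorm_apply, regularRep_evalXPow hφ hσ hn, Matrix.scalar_apply, Matrix.det_diagonal,
    Finset.prod_const, Finset.card_univ, ← Nat.card_eq_fintype_card,
    IsGalois.card_aut_eq_finrank, hn, map_pow, Polynomial.map_pow]

omit [IsGalois F K] in
-- The row indexed by `1` already displays every coefficient of `p`.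
theorem regularRep_injective : Function.Injective (regularRep hφ) := by
  classical
  rw [injective_iff_map_eq_zero]
  intro p hp
  refine SkewMonoidAlgebra.ext fun k => ?_
  have := coeff_regularRep hφ p k.toAdd 1 (σ ^ k.toAdd)
  rw [hp] at this
  simpa [SkewPolynomial.coeff] using this.symm

theorem evalXPow_mem_center (hφ : ∀ a : K, (SkewPolynomial.φ : K →+* K) a = σ a)
    (hσ : ∀ τ : K ≃ₐ[F] K, τ ∈ Subgroup.zpowers σ)
    (hn : Module.finrank F K = n) (a : F[X]) :
    (evalXPow n a : SkewPolynomial K) ∈ Subring.center (SkewPolynomial K) := by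
  classical
  rw [Subring.mem_center_iff]
  intro p
  apply regularRep_injective hφ
  rw [map_mul, map_mul, regularRep_evalXPow hφ hσ hn]
  exact ((Matrix.scalar_commute _ (fun r => Commute.all _ _) _).eq).symm

theorem evalXPow_mul (hφ : ∀ a : K, (SkewPolynomial.φ : K →+* K) a = σ a)
    (hσ : ∀ τ : K ≃ₐ[F] K, τ ∈ Subgroup.zpowers σ)
    (hn : Module.finrank F K = n) (a b : F[X]) :
    (evalXPow n (a * b) : SkewPolynomial K) = evalXPow n a * evalXPow n b := by
  classical
  apply regularRep_injective hφ
  rw [map_mul, regularRep_evalXPow hφ hσ hn, regularRep_evalXPow hφ hσ hn,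
    regularRep_evalXPow hφ hσ hn, map_mul, Polynomial.map_mul, map_mul]

end CyclicGalois

/-- Euclid's lemma: with `Rf + Ra = Rd`, either `d` is a left associate of `f`, or `d` is a unit and
a Bézout relation can be multiplied by the central `b`. -/
theorem isRightDivisor_or_of_irreducible_of_mem_center {R : Type*} [Ring R]
    (hR : ∀ I : Ideal R, ∃ d, I = Ideal.span {d}) {f a b : R} (hf : Irreducible f)
    (hb : b ∈ Subring.center R) (h : IsRightDivisor f (a * b)) :
    IsRightDivisor f a ∨ IsRightDivisor f b := by
  obtain ⟨d, hd⟩ := hR (Ideal.span {f, a})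
  have hfd : f ∈ Ideal.span {d} := hd ▸ Ideal.subset_span (by simp)
  have had : a ∈ Ideal.span {d} := hd ▸ Ideal.subset_span (by simp)
  obtain ⟨q, hq⟩ := Ideal.mem_span_singleton'.mp hfd
  obtain ⟨w, hw⟩ := Ideal.mem_span_singleton'.mp had
  rcases hf.isUnit_or_isUnit hq.symm with hu | hu
  · obtain ⟨u, rfl⟩ := hu
    left
    refine ⟨w * ↑u⁻¹, ?_⟩
    rw [← hq, mul_assoc, Units.inv_mul_cancel_left, hw]
  · right
    have hd1 : d ∈ Ideal.span {f, a} := hd ▸ Ideal.subset_span (by simp)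
    obtain ⟨x, y, hxy⟩ := Submodule.mem_span_pair.mp hd1
    obtain ⟨u, rfl⟩ := hu
    obtain ⟨q', hq'⟩ := h
    have hc := Subring.mem_center_iff.mp hb
    refine ⟨↑u⁻¹ * (b * x + y * q'), ?_⟩
    have hub : (u : R) * b = (b * x + y * q') * f := by
      rw [← hxy, smul_eq_mul, smul_eq_mul, add_mul, hc (x * f), mul_assoc y a, hq', add_mul,
        mul_assoc b, mul_assoc y]
    rw [mul_assoc, ← hub, Units.inv_mul_cancel_left]

/-! ### Right division and degrees in skew polynomial rings -/

section Division

variable {K : Type*} [Field K] [MulSemiringAction (Multiplicative ℕ) K]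

theorem coeff_monomial_mul (j k : ℕ) (c : K) (p : SkewPolynomial K) :
    (SkewPolynomial.monomial j c * p).coeff (j + k) =
      c * (SkewPolynomial.φ : K →+* K)^[j] (p.coeff k) := by
  rw [SkewPolynomial.φ_iterate_apply]
  refine SkewMonoidAlgebra.coeff_single_mul_aux p fun a => ?_
  rw [ofAdd_add]
  exact mul_right_inj _

omit [MulSemiringAction (Multiplicative ℕ) K] in
theorem coeff_sub_apply (p q : SkewPolynomial K) (k : ℕ) :
    (p - q).coeff k = p.coeff k - q.coeff k := by
  simp [SkewPolynomial.coeff]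

omit [MulSemiringAction (Multiplicative ℕ) K] in
theorem eq_zero_of_coeff_eq_zero {p : SkewPolynomial K} (h : ∀ k, p.coeff k = 0) : p = 0 :=
  SkewMonoidAlgebra.ext fun k => h k.toAdd

omit [MulSemiringAction (Multiplicative ℕ) K] in
theorem exists_coeff_eq_zero_of_le (p : SkewPolynomial K) : ∃ N, ∀ k, N ≤ k → p.coeff k = 0 := by
  obtain ⟨N, hN⟩ := p.support.exists_nat_subset_range
  refine ⟨N, fun k hk => ?_⟩
  by_contra hne
  exact absurd (Finset.mem_range.mp (hN (SkewPolynomial.mem_support_iff.mpr hne))) hk.not_gt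

/-- Skew polynomial rings over a field are left principal ideal rings. -/
theorem exists_eq_span_singleton (I : Ideal (SkewPolynomial K)) : ∃ d, I = Ideal.span {d} := by
  classical
  by_cases hI : ∃ d ∈ I, d ≠ 0
  swap
  · push Not at hI
    exact ⟨0, by rw [Ideal.span_singleton_zero]; exact (Submodule.eq_bot_iff I).mpr hI⟩
  have hex : ∃ N, ∃ d ∈ I, d ≠ 0 ∧ ∀ k, N ≤ k → d.coeff k = 0 := by
    obtain ⟨d, hd, hd0⟩ := hI
    obtain ⟨N, hN⟩ := exists_coeff_eq_zero_of_le d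
    exact ⟨N, d, hd, hd0, hN⟩
  obtain ⟨d, hdI, hd0, hd⟩ := Nat.find_spec hex
  have hmin := fun N => Nat.find_min hex (m := N)
  generalize Nat.find hex = N₀ at hd hmin
  -- The bound `N₀` is strict, so `N₀ = 0` would force `d = 0`; otherwise `d` has degree `e = N₀ -
  -- 1`.
  obtain _ | e := N₀
  · exact absurd (eq_zero_of_coeff_eq_zero fun k => hd k (Nat.zero_le k)) hd0
  have he : d.coeff e ≠ 0 := by
    intro h0
    refine hmin e (Nat.lt_succ_self e) ⟨d, hdI, hd0, fun k hk => ?_⟩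
    rcases hk.eq_or_lt with rfl | hlt
    · exact h0
    · exact hd k hlt
  refine ⟨d, le_antisymm ?_ ((Ideal.span_singleton_le_iff_mem I).mpr hdI)⟩
  suffices ∀ N, ∀ p ∈ I, (∀ k, N ≤ k → p.coeff k = 0) → p ∈ Ideal.span {d} by
    intro p hp
    obtain ⟨N, hN⟩ := exists_coeff_eq_zero_of_le p
    exact this N p hp hN
  intro N
  induction N with
  | zero =>
    intro p _ hp
    rw [eq_zero_of_coeff_eq_zero fun k => hp k (Nat.zero_le k)]
    exact zero_mem _
  | succ N ih =>
    intro p hpI hp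
    rcases lt_or_ge N e with hlt | hge
    · have : p = 0 := by
        by_contra hp0
        exact hmin (N + 1) (by omega) ⟨p, hpI, hp0, hp⟩
      rw [this]
      exact zero_mem _
    obtain ⟨j, rfl⟩ := Nat.exists_eq_add_of_le' hge
    -- Chosen so that `c t ^ j d` cancels the coefficient of `p` at `j + e`; moving `t ^ j` past the
    -- leading coefficient of `d` twists it by `φ^[j]`.
    set c : K := p.coeff (j + e) / (SkewPolynomial.φ : K →+* K)^[j] (d.coeff e) with hc
    have hne : (SkewPolynomial.φ : K →+* K)^[j] (d.coeff e) ≠ 0 := fun h =>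
      he ((RingHom.injective _).iterate j (h.trans (iterate_map_zero _ _).symm))
    have hm : SkewPolynomial.monomial j c * d ∈ Ideal.span {d} :=
      Ideal.mul_mem_left _ _ (Ideal.mem_span_singleton_self d)
    have hr := ih (p - SkewPolynomial.monomial j c * d)
      (sub_mem hpI (Ideal.mul_mem_left _ _ hdI)) (by
        intro k hk
        obtain ⟨i, rfl⟩ := Nat.exists_eq_add_of_le (le_of_add_le_left hk)
        rw [coeff_sub_apply, coeff_monomial_mul]
        rcases (Nat.le_of_add_le_add_left hk).eq_or_lt with rfl | hlt
        · rw [hc, div_mul_cancel₀ _ hne, sub_self]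
        · rw [hp _ (by omega), hd i hlt, SkewPolynomial.φ_iterate_apply, smul_zero, mul_zero,
            sub_self])
    simpa using add_mem hr hm

omit [MulSemiringAction (Multiplicative ℕ) K] in
theorem degree_eq_iff {p : SkewPolynomial K} {d : ℕ} :
    degree p = (d : WithBot ℕ) ↔ p.coeff d ≠ 0 ∧ ∀ k, d < k → p.coeff k = 0 := by
  constructor
  · intro h
    refine ⟨SkewPolynomial.mem_support_iff.mp (Finset.mem_of_max h), fun k hk => ?_⟩
    by_contra hne
    exact absurd (Finset.le_max_of_eq (SkewPolynomial.mem_support_iff.mpr hne) h) hk.not_ge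
  · rintro ⟨h0, h⟩
    refine le_antisymm (Finset.max_le fun k hk => ?_)
      (Finset.le_max (SkewPolynomial.mem_support_iff.mpr h0))
    by_contra hlt
    exact SkewPolynomial.mem_support_iff.mp hk (h k (WithBot.coe_lt_coe.mp (not_le.mp hlt)))

omit [MulSemiringAction (Multiplicative ℕ) K] in
theorem exists_degree_eq {p : SkewPolynomial K} (hp : p ≠ 0) :
    ∃ d : ℕ, degree p = (d : WithBot ℕ) :=
  Finset.max_of_nonempty (Finset.nonempty_iff_ne_empty.mpr (by simpa using hp))

omit [MulSemiringAction (Multiplicative ℕ) K] in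
theorem IsMonic.coeff_eq_one {p : SkewPolynomial K} (hp : IsMonic p) {d : ℕ}
    (hd : degree p = (d : WithBot ℕ)) : p.coeff d = 1 := by
  obtain ⟨e, he, h1⟩ := hp
  rw [hd] at he
  have hde : d = e := WithBot.coe_injective he
  rwa [hde]

end Division

/-! ### Irreducibility of `ĥ` and norms of divisors of `h` -/

section CyclicGalois

variable {F K : Type*} [Field F] [Field K] [Algebra F K] [FiniteDimensional F K] [IsGalois F K]
  {σ : K ≃ₐ[F] K} [MulSemiringAction (Multiplicative ℕ) K] {n : ℕ}
  (hφ : ∀ a : K, (SkewPolynomial.φ : K →+* K) a = σ a)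

include hφ

open scoped Classical in
theorem coeff_redNorm_of_degree_eq (hn : Module.finrank F K = n) {p : SkewPolynomial K} {d : ℕ}
    (hd : degree p = (d : WithBot ℕ)) :
    (redNorm hφ p).coeff (n * d) = algebraMap F K (Algebra.norm F (p.coeff d)) *
        ((Equiv.Perm.sign (Equiv.mulRight σ) : ℤ) : K) ^ d := by
  rw [← coeff_redNorm_top hφ (degree_eq_iff.mp hd).2, ← Nat.card_eq_fintype_card,
    IsGalois.card_aut_eq_finrank, hn]

theorem natDegree_redNorm (hn : Module.finrank F K = n) {p : SkewPolynomial K} {d : ℕ}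
    (hd : degree p = (d : WithBot ℕ)) : (redNorm hφ p).natDegree = n * d := by
  classical
  refine natDegree_eq_of_le_of_coeff_ne_zero ?_ ?_
  · rw [← hn, ← IsGalois.card_aut_eq_finrank, Nat.card_eq_fintype_card]
    exact natDegree_redNorm_le hφ (degree_eq_iff.mp hd).2
  · rw [coeff_redNorm_of_degree_eq hφ hn hd]
    refine mul_ne_zero ?_ (pow_ne_zero _ ?_)
    · rw [_root_.map_ne_zero]
      exact Algebra.norm_ne_zero_iff.mpr (degree_eq_iff.mp hd).1
    · exact ((Units.isUnit _).map (Int.castRingHom K)).ne_zero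

omit [IsGalois F K] in
theorem mul_eq_one_of_mul_eq_one {p q : SkewPolynomial K} (h : p * q = 1) : q * p = 1 := by
  classical
  apply regularRep_injective hφ
  rw [map_mul, map_one]
  exact _root_.mul_eq_one_comm.mp (by rw [← map_mul, h, map_one])

theorem degree_evalXPow (hσ : ∀ τ : K ≃ₐ[F] K, τ ∈ Subgroup.zpowers σ)
    (hn : Module.finrank F K = n) {a : F[X]} (ha : a ≠ 0) :
    degree (evalXPow n a : SkewPolynomial K) = ((n * a.natDegree : ℕ) : WithBot ℕ) := by
  have hn0 : 0 < n := hn ▸ Module.finrank_pos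
  have h0 : (evalXPow n a : SkewPolynomial K) ≠ 0 := by
    intro h
    have h1 := redNorm_evalXPow hφ hσ hn a
    rw [h, eq_comm] at h1
    have h2 : (redNorm hφ (0 : SkewPolynomial K)) = 0 := by
      classical
      rw [redNorm_apply, map_zero]
      exact Matrix.det_zero
    rw [h2, Polynomial.map_eq_zero, expand_eq_zero hn0] at h1
    exact ha (pow_eq_zero_iff hn0.ne' |>.mp h1)
  obtain ⟨d, hd⟩ := exists_degree_eq h0
  have h1 := natDegree_redNorm hφ hn hd
  rw [redNorm_evalXPow hφ hσ hn, natDegree_map, natDegree_expand, natDegree_pow, mul_comm] at h1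
  rw [hd, Nat.eq_of_mul_eq_mul_left hn0 h1.symm]

/-- If `a = b c` with monic factors, Euclid's lemma makes `f` divide one of the two central factors,
and minimality leaves degree zero for the other. -/
theorem irreducible_of_isMinimalCentralLeftMultiple
    (hσ : ∀ τ : K ≃ₐ[F] K, τ ∈ Subgroup.zpowers σ) (hn : Module.finrank F K = n)
    {f : SkewPolynomial K} (hf : Irreducible f) {a : F[X]} (ha : a.Monic)
    (hmin : IsMinimalCentralLeftMultiple F n f (evalXPow n a)) : Irreducible a := by
  have hn0 : 0 < n := hn ▸ Module.finrank_pos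
  have key : ∀ b : F[X], b.Monic → IsRightDivisor f (evalXPow n b) →
      a.natDegree ≤ b.natDegree := by
    intro b hb hfb
    have := hmin.2 _ ⟨evalXPow_mem_center hφ hσ hn b, hfb, b, hb, rfl⟩
    rw [degree_evalXPow hφ hσ hn ha.ne_zero, degree_evalXPow hφ hσ hn hb.ne_zero] at this
    exact Nat.le_of_mul_le_mul_left (WithBot.coe_le_coe.mp this) hn0
  rw [ha.irreducible_iff_natDegree]
  constructor
  · rintro rfl
    obtain ⟨q, hq⟩ := hmin.1.2.1
    rw [evalXPow, eval₂_one] at hq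
    exact hf.not_isUnit ⟨⟨f, q, mul_eq_one_of_mul_eq_one hφ hq.symm, hq.symm⟩, rfl⟩
  · rintro b c hb hc rfl
    have h := hmin.1.2.1
    rw [evalXPow_mul hφ hσ hn] at h
    rw [hb.natDegree_mul hc] at key
    rcases isRightDivisor_or_of_irreducible_of_mem_center exists_eq_span_singleton hf
      (evalXPow_mem_center hφ hσ hn c) h with h | h
    · have := key b hb h
      omega
    · have := key c hc h
      omega

open scoped Classical in
theorem norm_coeff_zero_of_dvd (hσ : ∀ τ : K ≃ₐ[F] K, τ ∈ Subgroup.zpowers σ)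
    (hn : Module.finrank F K = n) {a : F[X]} (ha : a.Monic) (hai : Irreducible a)
    {g : SkewPolynomial K} (hg : IsMonic g) {l : ℕ}
    (hgl : degree g = ((a.natDegree * l : ℕ) : WithBot ℕ))
    (hdvd : IsRightDivisor g (evalXPow n a) ∨ IsLeftDivisor g (evalXPow n a)) :
    Algebra.norm F (g.coeff 0) =
      ((Equiv.Perm.sign (Equiv.mulRight σ) : ℤ) : F) ^ (a.natDegree * l) * a.coeff 0 ^ l := by
  have hn0 : 0 < n := hn ▸ Module.finrank_pos
  have hinj := (algebraMap F K).injective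
  obtain ⟨Q, hQ⟩ := exists_redNorm_eq_map_expand hφ hσ hn g
  have hQa : Q ∣ a ^ n := by
    obtain ⟨q, hq⟩ : ∃ q, evalXPow n a = q * g ∨ evalXPow n a = g * q := by
      rcases hdvd with ⟨q, hq⟩ | ⟨q, hq⟩
      exacts [⟨q, .inl hq⟩, ⟨q, .inr hq⟩]
    obtain ⟨Q', hQ'⟩ := exists_redNorm_eq_map_expand hφ hσ hn q
    -- Norms commute, so left and right divisors are treated alike.
    have hmul : redNorm hφ (evalXPow n a) = redNorm hφ g * redNorm hφ q := by
      rcases hq with hq | hq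
      · rw [hq, map_mul, mul_comm]
      · rw [hq, map_mul]
    rw [redNorm_evalXPow hφ hσ hn, hQ, hQ', ← Polynomial.map_mul, ← map_mul] at hmul
    exact ⟨Q', expand_injective hn0 (map_injective _ hinj hmul)⟩
  obtain ⟨i, -, hi⟩ := (dvd_prime_pow hai.prime n).mp hQa
  obtain ⟨u, hu⟩ := hi.symm
  obtain ⟨c, hc, hcu⟩ := Polynomial.isUnit_iff.mp u.isUnit
  rw [← hcu] at hu
  have hc0 : c ≠ 0 := hc.ne_zero
  have hdeg : Q.natDegree = a.natDegree * l := by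
    have h1 := natDegree_redNorm hφ hn hgl
    rw [hQ, natDegree_map, natDegree_expand, mul_comm] at h1
    exact Nat.eq_of_mul_eq_mul_left hn0 h1
  have hil : i = l := by
    rw [← hu, natDegree_mul_C hc0, natDegree_pow, mul_comm] at hdeg
    exact Nat.eq_of_mul_eq_mul_left hai.natDegree_pos hdeg
  subst hil
  -- As `a` and `g` are monic, comparing top coefficients leaves only the sign.
  have htop : c = ((Equiv.Perm.sign (Equiv.mulRight σ) : ℤ) : F) ^ (a.natDegree * i) := by
    have h1 := coeff_redNorm_of_degree_eq hφ hn hgl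
    rw [hg.coeff_eq_one hgl, map_one, map_one, one_mul, hQ, coeff_map, coeff_expand_mul' hn0,
      ← hdeg, coeff_natDegree, ← hu, leadingCoeff_mul, leadingCoeff_C, (ha.pow i).leadingCoeff,
      one_mul, hu, hdeg] at h1
    apply hinj
    rw [h1, map_pow, map_intCast]
  have hzero := coeff_zero_redNorm hφ g
  rw [hQ, coeff_map, coeff_zero_eq_eval_zero, expand_eval, zero_pow hn0.ne', ← hu, eval_mul,
    eval_pow, eval_C, ← coeff_zero_eq_eval_zero] at hzero
  rw [← hinj hzero, htop, mul_comm]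

end CyclicGalois

end SkewPoly

/-- `K/F` is a cyclic Galois extension of degree `n` whose Galois group is generated by `σ`. The
ring `K[t;σ]` is Mathlib's `SkewPolynomial K`, whose twist `φ` (defined by `t a = φ(a) t`) is `σ`. -/
theorem mainTheorem11 {F K : Type*} [Field F] [Field K] [Algebra F K]
    [FiniteDimensional F K] [IsGalois F K]
    (σ : K ≃ₐ[F] K) (hσ : ∀ τ : K ≃ₐ[F] K, τ ∈ Subgroup.zpowers σ)
    (n : ℕ) (hn : Module.finrank F K = n)
    [MulSemiringAction (Multiplicative ℕ) K]
    (hφ : ∀ a : K, (SkewPolynomial.φ : K →+* K) a = σ a)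
    (m : ℕ) (f : SkewPolynomial K) (hf_deg : SkewPoly.degree f = (m : WithBot ℕ))
    (hf_monic : SkewPoly.IsMonic f) (hf_irr : Irreducible f)
    (hf_t : SkewPoly.IsRightCoprime f SkewPolynomial.X)
    (hf_inv : ¬ SkewPoly.IsRightInvariant f)
    (h : SkewPolynomial K) (hh : SkewPoly.IsMinimalCentralLeftMultiple F n f h)
    (hh_deg : SkewPoly.degree h = ((m * n : ℕ) : WithBot ℕ))
    (l : ℕ) (g : SkewPolynomial K) (hg_monic : SkewPoly.IsMonic g)
    (hg_dvd : SkewPoly.IsRightDivisor g h ∨ SkewPoly.IsLeftDivisor g h)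
    (hg_deg : SkewPoly.degree g = ((m * l : ℕ) : WithBot ℕ)) :
    Algebra.norm F (g.coeff 0) = Algebra.norm F (f.coeff 0) ^ l := by
  have hn0 : 0 < n := hn ▸ Module.finrank_pos
  obtain ⟨a, ha, rfl⟩ := hh.1.2.2
  have hai := SkewPoly.irreducible_of_isMinimalCentralLeftMultiple hφ hσ hn hf_irr ha hh
  have hm : m = a.natDegree := by
    rw [SkewPoly.degree_evalXPow hφ hσ hn ha.ne_zero, mul_comm m] at hh_deg
    exact (Nat.eq_of_mul_eq_mul_left hn0 (WithBot.coe_injective hh_deg)).symm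
  subst hm
  -- The sign never needs evaluating: its exponent `m * l` for `g` is `l` times the exponent for
  -- `f`.
  rw [SkewPoly.norm_coeff_zero_of_dvd hφ hσ hn ha hai hg_monic hg_deg hg_dvd,
    SkewPoly.norm_coeff_zero_of_dvd hφ hσ hn ha hai hf_monic (l := 1) (by rw [mul_one, hf_deg])
      (.inl hh.1.2.1)]
  ring
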